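/- Consider the stable marriage problem with a set $M$ of $n$ men and a set $W$ of $n$ women ($n \ge 1$), where every agent has a strict total order over the agents of the other side. For a profile $\succ$, let $\mathrm{DA}(\succ)$ be the matching computed by men-proposing deferred acceptance. Fix a man $m$ (the accomplice), let $\mu = \mathrm{DA}(\succ)$, and for $X \subseteq W$ let $\mu^X$ be the matching computed by deferred acceptance when $m$ instead reports the list obtained from his true list by moving the women of $X$ (other than $\mu(m)$) who stand below $\mu(m)$ to positions above $\mu(m)$, while all other agents report truthfully. Let $W^{\mathrm{NR}}$ be the set of all $w \in W$ such that $m$ does not find $\mu^{\{w\}}(m)$ worse than $\mu(m)$. A set $Y \subseteq W^{\mathrm{NR}}$ is a minimum no-regret push-up set if $\mu^Y = \mu^{W^{\mathrm{NR}}}$ and no $Z \subseteq W^{\mathrm{NR}}$ with $\mu^Z = \mu^{W^{\mathrm{NR}}}$ satisfies $|Z| < |Y|$. Every minimum no-regret push-up set $Y$ (for every such instance and every accomplice) satisfies $$|Y| \le \left\lfloor \frac{n-1}{2} \right\rfloor .$$ This bound is tight: for every $n \ge 1$ there are an instance with $n$ men and $n$ women, an accomplice, and a minimum no-regret push-up set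 $Y$ with $|Y| = \lfloor (n-1)/2 \rfloor$. -/

import Mathlib

/-- An instance of the stable marriage problem: equally many men and women, each agent having a
strict total order over the agents of the other side. `man m w w'` says that `m` prefers `w` to
`w'`; `woman w m m'` says that `w` prefers `m` to `m'`. -/
structure Market (M W : Type*) [Fintype M] [Fintype W] where
  card_eq : Fintype.card M = Fintype.card W
  man : M → W → W → Prop
  woman : W → M → M → Prop
  man_order : ∀ m, IsStrictTotalOrder W (man m)
  woman_order : ∀ w, IsStrictTotalOrder M (woman w)

namespace Market

variable {M W : Type*} [Fintype M] [Fintype W]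

/-- When `R` is the set of rejections so far, `w` is the favorite woman of `m` among those who have
not rejected him: the woman to whom `m` proposes, or to whom he is tentatively matched. -/
def Target (P : Market M W) (R : Set (M × W)) (m : M) (w : W) : Prop :=
  (m, w) ∉ R ∧ ∀ w', w' ≠ w → (m, w') ∉ R → P.man m w w'

/-- One round of deferred acceptance. Every woman tentatively keeps her favorite among the men
whose proposals she currently has (the man she already holds and the new proposers), and rejects
the others. -/
def round (P : Market M W) (R : Set (M × W)) : Set (M × W) :=
  R ∪ {p | P.Target R p.1 p.2 ∧ ∃ m', P.Target R m' p.2 ∧ P.woman p.2 m' p.1}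

/-- The rejections made in the first `k` rounds. -/
def rejections (P : Market M W) (k : ℕ) : Set (M × W) :=
  P.round^[k] ∅

/-- All rejections made during the execution. As there are finitely many pairs, this is the state
after finitely many rounds, when no further proposals can be made. -/
def finalRejections (P : Market M W) : Set (M × W) :=
  ⋃ k, P.rejections k

theorem rejections_succ (P : Market M W) (k : ℕ) :
    P.rejections (k + 1) = P.round (P.rejections k) :=
  Function.iterate_succ_apply' _ _ _

theorem rejections_mono (P : Market M W) : Monotone P.rejections :=
  monotone_nat_of_le_succ fun k => by
    rw [rejections_succ]
    exact Set.subset_union_left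

theorem exists_rejections_eq_final (P : Market M W) :
    ∃ k, P.rejections k = P.finalRejections ∧ P.round P.finalRejections = P.finalRejections := by
  obtain ⟨k, hk⟩ := WellFoundedGT.monotone_chain_condition
    (⟨P.rejections, P.rejections_mono⟩ : ℕ →o Set (M × W))
  have h : P.rejections k = P.finalRejections := by
    refine Set.Subset.antisymm (Set.subset_iUnion P.rejections k) (Set.iUnion_subset fun j => ?_)
    rcases le_total k j with hj | hj
    · exact (hk j hj).ge
    · exact P.rejections_mono hj
  refine ⟨k, h, ?_⟩
  rw [← h, ← rejections_succ]
  exact (hk (k + 1) k.le_succ).symm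

theorem exists_best {α : Type*} [Finite α] (r : α → α → Prop) [IsStrictTotalOrder α r]
    {S : Set α} (hS : S.Nonempty) : ∃ a ∈ S, ∀ b, b ≠ a → b ∈ S → r a b := by
  obtain ⟨a, ha, h⟩ := (Finite.wellFounded_of_trans_of_irrefl r).has_min S hS
  refine ⟨a, ha, fun b hb hbS => ?_⟩
  rcases trichotomous_of r a b with h1 | h1 | h1
  · exact h1
  · exact absurd h1.symm hb
  · exact absurd h1 (h b hbS)

/-- A woman who has rejected somebody holds a proposal. -/
theorem exists_target_of_rejected (P : Market M W) (k : ℕ) :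
    ∀ m w, (m, w) ∈ P.rejections k → ∃ m', P.Target (P.rejections k) m' w := by
  induction k with
  | zero => intro m w h; exact absurd h (Set.notMem_empty _)
  | succ k ih =>
    intro m w h
    have hne : {m' | P.Target (P.rejections k) m' w}.Nonempty := by
      rw [rejections_succ] at h
      rcases h with h | ⟨h, -⟩
      · exact ih m w h
      · exact ⟨m, h⟩
    have := P.woman_order w
    obtain ⟨a, ha, hbest⟩ := exists_best (P.woman w) hne
    refine ⟨a, ?_, fun w' hw' hn => ha.2 w' hw' fun hr =>
      hn (P.rejections_mono k.le_succ hr)⟩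
    rw [rejections_succ]
    rintro (hr | ⟨-, m', hm', hlt⟩)
    · exact ha.1 hr
    · have hne' : m' ≠ a := by
        rintro rfl
        exact irrefl_of (P.woman w) _ hlt
      exact asymm_of (P.woman w) hlt (hbest m' hne' hm')

theorem Target.unique {P : Market M W} {R : Set (M × W)} {m : M} {w w' : W}
    (h : P.Target R m w) (h' : P.Target R m w') : w = w' := by
  by_contra hne
  have := P.man_order m
  exact asymm_of (P.man m) (h.2 w' (Ne.symm hne) h'.1) (h'.2 w hne h.1)

/-- When deferred acceptance stops, every man is matched. -/
theorem exists_partner (P : Market M W) (m : M) : ∃ w, P.Target P.finalRejections m w := by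
  obtain ⟨k, hk, -⟩ := P.exists_rejections_eq_final
  rw [← hk]
  by_cases hS : {w | (m, w) ∉ P.rejections k}.Nonempty
  · have := P.man_order m
    obtain ⟨w, hw, hb⟩ := exists_best (P.man m) hS
    exact ⟨w, hw, hb⟩
  · have hall : ∀ w, (m, w) ∈ P.rejections k := by
      intro w
      by_contra hw
      exact hS ⟨w, hw⟩
    choose f hf using fun w => P.exists_target_of_rejected k m w (hall w)
    have hinj : Function.Injective f := fun w w' h => (hf w).unique (h ▸ hf w')
    have hsurj := ((Fintype.bijective_iff_injective_and_card f).2 ⟨hinj, P.card_eq.symm⟩).2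
    obtain ⟨w, hw⟩ := hsurj m
    exact absurd (hall w) (hw ▸ (hf w).1)

/-- The matching computed by men-proposing deferred acceptance, as the map that sends each man to
his partner. -/
noncomputable def DA (P : Market M W) (m : M) : W :=
  (P.exists_partner m).choose

theorem target_DA (P : Market M W) (m : M) : P.Target P.finalRejections m (P.DA m) :=
  (P.exists_partner m).choose_spec

/-- The outcome of deferred acceptance is a matching: every woman has exactly one partner. -/
theorem DA_bijective (P : Market M W) : Function.Bijective P.DA := by
  refine (Fintype.bijective_iff_injective_and_card _).2 ⟨fun a b hab => ?_, P.card_eq⟩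
  by_contra hne
  obtain ⟨-, -, hfix⟩ := P.exists_rejections_eq_final
  have ha := P.target_DA a
  have hb := P.target_DA b
  rw [← hab] at hb
  have := P.woman_order (P.DA a)
  rcases trichotomous_of (P.woman (P.DA a)) a b with h | h | h
  · exact hb.1 (hfix ▸ Or.inr ⟨hb, a, ha, h⟩)
  · exact hne h
  · exact ha.1 (hfix ▸ Or.inr ⟨ha, b, hb, h⟩)

open scoped Classical in
/-- The block of `m`'s list in which `w` stands after `m` pushes up `X`: block 2 is the part above
his partner `DA P m`, block 1 is the partner herself, and block 0 is the part below. -/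
noncomputable def pushUpBlock (P : Market M W) (m : M) (X : Finset W) (w : W) : ℕ :=
  if w = P.DA m then 1 else if P.man m w (P.DA m) ∨ w ∈ X then 2 else 0

/-- The list of `m` after he pushes up `X`: the women of `X` are moved above `DA P m`, and inside
each block the true order is kept. -/
def pushUpList (P : Market M W) (m : M) (X : Finset W) (w w' : W) : Prop :=
  P.pushUpBlock m X w' < P.pushUpBlock m X w ∨
    P.pushUpBlock m X w = P.pushUpBlock m X w' ∧ P.man m w w'

theorem pushUpList_order (P : Market M W) (m : M) (X : Finset W) :
    IsStrictTotalOrder W (P.pushUpList m X) := by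
  have := P.man_order m
  refine { irrefl := ?_, trans := ?_, trichotomous := ?_ }
  · intro a b hab hba
    simp only [pushUpList, not_or, not_and, not_lt] at hab hba
    have he : P.pushUpBlock m X a = P.pushUpBlock m X b := le_antisymm hab.1 hba.1
    rcases trichotomous_of (P.man m) a b with h | h | h
    · exact absurd h (hab.2 he)
    · exact h
    · exact absurd h (hba.2 he.symm)
  · rintro a (h | ⟨-, h⟩)
    · exact lt_irrefl _ h
    · exact irrefl_of (P.man m) _ h
  · rintro a b c (h | ⟨h, h'⟩) (k | ⟨k, k'⟩)
    · exact Or.inl (k.trans h)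
    · exact Or.inl (k ▸ h)
    · exact Or.inl (h ▸ k)
    · exact Or.inr ⟨h.trans k, trans_of (P.man m) h' k'⟩

open scoped Classical in
/-- The profile in which `m` reports the list obtained from his true list by pushing up `X`, and
everybody else is truthful. -/
noncomputable def pushUp (P : Market M W) (m : M) (X : Finset W) : Market M W where
  card_eq := P.card_eq
  man := Function.update P.man m (P.pushUpList m X)
  woman := P.woman
  man_order := fun m' => by
    by_cases h : m' = m
    · subst h
      rw [Function.update_self]
      exact P.pushUpList_order m' X
    · rw [Function.update_of_ne h]
      exact P.man_order m'
  woman_order := P.woman_order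

/-- Pushing up `X` is no-regret for `m`: his partner does not get worse, by his true list. -/
def NoRegret (P : Market M W) (m : M) (X : Finset W) : Prop :=
  P.man m ((P.pushUp m X).DA m) (P.DA m) ∨ (P.pushUp m X).DA m = P.DA m

open scoped Classical in
/-- The no-regret set: the women whom `m` can push up individually without regret. -/
noncomputable def noRegretSet (P : Market M W) (m : M) : Finset W :=
  Finset.univ.filter fun w => P.NoRegret m {w}

/-- `Y` is a minimum no-regret push-up set for the accomplice `m`. -/
def IsMinimumNoRegretPushUpSet (P : Market M W) (m : M) (Y : Finset W) : Prop :=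
  Y ⊆ P.noRegretSet m ∧
    (P.pushUp m Y).DA = (P.pushUp m (P.noRegretSet m)).DA ∧
    ¬ ∃ Z : Finset W, Z ⊆ P.noRegretSet m ∧
      (P.pushUp m Z).DA = (P.pushUp m (P.noRegretSet m)).DA ∧ Z.card < Y.card

end Market

/-!
In a stable matching a man's gain is always his partner's loss, so giving every man the worse of
his partners in two stable matchings gives every woman the better of hers, and the result is again
stable. If the accomplice `m` keeps his partner, then pushing up `X` demands from a stable matching
exactly that the women of `X` do at least as well as with `m`. This demand survives passing to
worse matchings, so the matching `μ^(X ∪ Y)` consists of the worse partners in `μ^X` and `μ^Y`.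

Hence, if no woman of `Y` can be dropped, the sets of men whose partners change when `y ∈ Y` is
dropped are pairwise disjoint: a man in two of them would have the same partner in `μ^Y` as in
`μ^(Y \ y)` or in `μ^(Y \ z)`. Each of these sets has at least two elements, because no two
matchings differ at one man only, and none contains `m`. So `2 |Y| ≤ n - 1`.

For tightness, pair off all the men but `m` (and one more, if `n` is even), and let each man like
best a woman who prefers his partner in the pair. One woman in each pair accepts `m` until she has
met the man she likes best, so pushing her up makes exactly that pair swap.
-/

theorem two_le_card_filter_ne {α β : Type*} [Fintype α] [DecidableEq β] {f g : α → β}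
    (hf : f.Injective) (hg : g.Surjective) (hne : f ≠ g) :
    2 ≤ (Finset.univ.filter fun a => f a ≠ g a).card := by
  obtain ⟨a, ha⟩ := Function.ne_iff.1 hne
  obtain ⟨b, hb⟩ := hg (f a)
  have hab : a ≠ b := fun h => ha (h ▸ hb.symm)
  refine Finset.one_lt_card.2 ⟨a, Finset.mem_filter_univ a |>.2 ha, b, ?_, hab⟩
  exact Finset.mem_filter_univ b |>.2 fun h => hab (hf (h.trans hb)).symm

namespace Market

attribute [instance] man_order woman_order

section Stability

variable {M W : Type*} [Fintype M] [Fintype W] {P : Market M W} {f g : M → W} {a b c : M} {w w' : W}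

/-- The weak preference of the man `a`: he likes `w` at least as much as `w'`. -/
def WeaklyPrefers (P : Market M W) (a : M) (w w' : W) : Prop :=
  P.man a w w' ∨ w = w'

theorem WeaklyPrefers.not_man (h : P.WeaklyPrefers a w w') : ¬ P.man a w' w := by
  rcases h with h | rfl
  · exact asymm_of (P.man a) h
  · exact irrefl_of (P.man a) w

theorem WeaklyPrefers.antisymm (h : P.WeaklyPrefers a w w') (h' : P.WeaklyPrefers a w' w) :
    w = w' :=
  h.resolve_left h'.not_man

/-- In the matching `f`, the woman `w` is matched to a man whom she likes at least as much as `a`,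
so that she would not leave him for `a`. -/
def Resists (P : Market M W) (f : M → W) (w : W) (a : M) : Prop :=
  ∃ c, f c = w ∧ (c = a ∨ P.woman w c a)

theorem resists_apply_iff (hf : f.Injective) :
    P.Resists f (f c) a ↔ c = a ∨ P.woman (f c) c a :=
  ⟨fun ⟨_, hd, h⟩ => hf hd ▸ h, fun h => ⟨c, rfl, h⟩⟩

/-- A stable matching: a bijection without blocking pairs. -/
structure Stable (P : Market M W) (f : M → W) : Prop where
  bijective : Function.Bijective f
  resists : ∀ a w, P.man a w (f a) → P.Resists f w a

theorem Stable.man_of_woman (hf : P.Stable f) (h : P.woman (f c) b c) : P.man b (f b) (f c) := by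
  rcases trichotomous_of (P.man b) (f b) (f c) with hb | hb | hb
  · exact hb
  · exact absurd (hf.bijective.1 hb ▸ h) (irrefl_of _ c)
  · rcases (resists_apply_iff hf.bijective.1).1 (hf.resists b (f c) hb) with rfl | h'
    · exact absurd h (irrefl_of _ c)
    · exact absurd h (asymm_of _ h')

theorem Target.exists_target_round {R : Set (M × W)} (h : P.Target R a w) :
    ∃ b, P.Target (P.round R) b w ∧ (b = a ∨ P.woman w b a) := by
  obtain ⟨b, hb, hbest⟩ := exists_best (P.woman w) (S := {b | P.Target R b w}) ⟨a, h⟩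
  have hkept : (b, w) ∉ P.round R := by
    rintro (hr | ⟨-, c, hc, hcb⟩)
    · exact hb.1 hr
    · obtain rfl | hne := eq_or_ne c b
      · exact irrefl_of (P.woman w) c hcb
      · exact asymm_of (P.woman w) hcb (hbest c hne hc)
  refine ⟨b, ⟨hkept, fun w' hw' hn => hb.2 w' hw' fun hr => hn (Or.inl hr)⟩, ?_⟩
  exact or_iff_not_imp_left.2 fun hba => hbest a (Ne.symm hba) h

theorem exists_preferred_target_of_mem_rejections {k : ℕ} (h : (a, w) ∈ P.rejections k) :
    ∃ b, P.Target (P.rejections k) b w ∧ P.woman w b a := by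
  induction k with
  | zero => exact absurd h (Set.notMem_empty _)
  | succ k ih =>
    rw [rejections_succ] at h ⊢
    obtain ⟨c, hc, hca⟩ : ∃ c, P.Target (P.rejections k) c w ∧ P.woman w c a :=
      h.elim ih And.right
    obtain ⟨b, hb, rfl | hbc⟩ := hc.exists_target_round
    · exact ⟨b, hb, hca⟩
    · exact ⟨b, hb, trans_of (P.woman w) hbc hca⟩

theorem stable_DA (P : Market M W) : P.Stable P.DA := by
  refine ⟨P.DA_bijective, fun a w h => ?_⟩
  have hrejected : (a, w) ∈ P.finalRejections := by
    by_contra hn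
    have hne : w ≠ P.DA a := fun he => irrefl_of (P.man a) w (he ▸ h)
    exact asymm_of (P.man a) h ((P.target_DA a).2 w hne hn)
  obtain ⟨k, hk, -⟩ := P.exists_rejections_eq_final
  obtain ⟨b, hb, hba⟩ := exists_preferred_target_of_mem_rejections (hk ▸ hrejected)
  exact ⟨b, (P.target_DA b).unique (hk ▸ hb), Or.inr hba⟩

theorem Stable.notMem_rejections (hf : P.Stable f) (k : ℕ) (a : M) :
    (a, f a) ∉ P.rejections k := by
  induction k generalizing a with
  | zero => exact Set.notMem_empty _
  | succ k ih =>
    rw [rejections_succ]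
    rintro (h | ⟨-, b, hb, hba⟩)
    · exact ih a h
    · have hman : P.man b (f b) (f a) := hf.man_of_woman hba
      have hne : f b ≠ f a := fun h => irrefl_of (P.man b) (f a) (h ▸ hman)
      exact asymm_of (P.man b) hman (hb.2 (f b) hne (ih b))

theorem Stable.weaklyPrefers_DA (hf : P.Stable f) (a : M) : P.WeaklyPrefers a (P.DA a) (f a) := by
  refine or_iff_not_imp_right.2 fun hne => (P.target_DA a).2 (f a) (Ne.symm hne) fun hr => ?_
  obtain ⟨k, hk⟩ := Set.mem_iUnion.1 hr
  exact hf.notMem_rejections k a hk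

theorem DA_eq_of_forall_not_man (hf : f.Bijective) (h : ∀ a w, ¬ P.man a w (f a)) : P.DA = f :=
  have hstable : P.Stable f := ⟨hf, fun a w haw => absurd haw (h a w)⟩
  funext fun a => (hstable.weaklyPrefers_DA a).resolve_left (h a _)

open scoped Classical in
/-- The meet of two matchings in the men's order: every man gets the worse of his partners in `f`
and `g`. -/
noncomputable def worse (P : Market M W) (f g : M → W) (a : M) : W :=
  if P.man a (f a) (g a) then g a else f a

theorem worse_eq_left_or_right (P : Market M W) (f g : M → W) (a : M) :
    P.worse f g a = f a ∨ P.worse f g a = g a := by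
  unfold worse
  split_ifs
  exacts [Or.inr rfl, Or.inl rfl]

theorem worse_eq_right (h : P.man a (f a) (g a)) : P.worse f g a = g a :=
  if_pos h

theorem worse_comm (P : Market M W) (f g : M → W) : P.worse f g = P.worse g f := by
  ext a
  rcases trichotomous_of (P.man a) (f a) (g a) with h | h | h
  · rw [worse_eq_right h, worse, if_neg (asymm_of _ h)]
  · simp only [worse, h, ite_self]
  · rw [worse_eq_right h, worse, if_neg (asymm_of _ h)]

theorem Stable.resists_worse_left (hf : P.Stable f) (hg : P.Stable g) (h : P.Resists f w a) :
    P.Resists (P.worse f g) w a := by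
  obtain ⟨c, rfl, hca⟩ := h
  obtain ⟨b, hb⟩ := hg.bijective.2 (f c)
  rcases trichotomous_of (P.woman (f c)) c b with hcb | rfl | hbc
  · have hman : P.man c (g c) (f c) := hb ▸ hg.man_of_woman (hb.symm ▸ hcb)
    exact ⟨c, by rw [worse_comm, worse_eq_right hman], hca⟩
  · exact ⟨c, (P.worse_eq_left_or_right f g c).elim id fun h => h.trans hb, hca⟩
  · have hman : P.man b (f b) (g b) := hb.symm ▸ hf.man_of_woman hbc
    refine ⟨b, (worse_eq_right hman).trans hb, Or.inr ?_⟩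
    exact hca.elim (fun h => h ▸ hbc) fun h => trans_of (P.woman (f c)) hbc h

theorem Stable.resists_worse_right (hf : P.Stable f) (hg : P.Stable g) (h : P.Resists g w a) :
    P.Resists (P.worse f g) w a :=
  P.worse_comm g f ▸ hg.resists_worse_left hf h

theorem Stable.worse (hf : P.Stable f) (hg : P.Stable g) : P.Stable (P.worse f g) := by
  have hsurj : Function.Surjective (P.worse f g) := fun w => by
    obtain ⟨c, hc⟩ := hf.bijective.2 w
    obtain ⟨b, hb, -⟩ := hf.resists_worse_left hg ⟨c, hc, Or.inl rfl⟩
    exact ⟨b, hb⟩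
  refine ⟨(Fintype.bijective_iff_surjective_and_card _).2 ⟨hsurj, P.card_eq⟩, fun a w h => ?_⟩
  rcases P.worse_eq_left_or_right f g a with ha | ha <;> rw [ha] at h
  · exact hf.resists_worse_left hg (hf.resists a w h)
  · exact hf.resists_worse_right hg (hg.resists a w h)

end Stability

section PushUp

variable {M W : Type*} [Fintype M] [Fintype W] {P : Market M W} {m : M} {X Y : Finset W}
  {f g : M → W} {w w' : W}

theorem pushUp_man_self (P : Market M W) (m : M) (X : Finset W) :
    (P.pushUp m X).man m = P.pushUpList m X := by
  simp only [pushUp, Function.update_self]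

theorem pushUp_man_of_ne {a : M} (h : a ≠ m) (X : Finset W) : (P.pushUp m X).man a = P.man a := by
  classical
  exact Function.update_of_ne h ..

theorem pushUpBlock_eq_two (hne : w ≠ P.DA m) (h : P.man m w (P.DA m) ∨ w ∈ X) :
    P.pushUpBlock m X w = 2 := by
  rw [pushUpBlock, if_neg hne, if_pos h]

theorem pushUpBlock_mono (hXY : X ⊆ Y) (w : W) : P.pushUpBlock m X w ≤ P.pushUpBlock m Y w := by
  unfold pushUpBlock
  have := @hXY w
  grind

theorem pushUpBlock_eq_of_weaklyPrefers (h : P.WeaklyPrefers m w (P.DA m)) :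
    P.pushUpBlock m X w = P.pushUpBlock m Y w := by
  obtain rfl | hne := eq_or_ne w (P.DA m)
  · simp only [pushUpBlock, if_true]
  · have h' := h.resolve_right hne
    rw [pushUpBlock_eq_two hne (Or.inl h'), pushUpBlock_eq_two hne (Or.inl h')]

theorem pushUpList_of_subset (hXY : X ⊆ Y) (hw : P.pushUpBlock m X w = P.pushUpBlock m Y w)
    (h : P.pushUpList m X w' w) : P.pushUpList m Y w' w := by
  have hle := pushUpBlock_mono (P := P) (m := m) hXY w'
  unfold pushUpList at h ⊢
  grind

theorem pushUpList_DA_iff :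
    P.pushUpList m X w (P.DA m) ↔ w ≠ P.DA m ∧ (P.man m w (P.DA m) ∨ w ∈ X) := by
  have := irrefl_of (P.man m) (P.DA m)
  unfold pushUpList pushUpBlock
  grind

theorem pushUpList_empty_of_man (h : P.man m w w') : P.pushUpList m ∅ w w' := by
  have hirrefl := irrefl_of (P.man m)
  have htrans := @trans_of _ (P.man m)
  unfold pushUpList pushUpBlock
  grind

theorem pushUp_empty (P : Market M W) (m : M) : P.pushUp m ∅ = P := by
  have hlist : P.pushUpList m ∅ = P.man m := by
    have := P.pushUpList_order m ∅
    ext w w'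
    refine ⟨fun h => ?_, pushUpList_empty_of_man⟩
    rcases trichotomous_of (P.man m) w w' with h' | rfl | h'
    · exact h'
    · exact absurd h (irrefl_of _ w)
    · exact absurd h (asymm_of _ (pushUpList_empty_of_man h'))
  simp only [pushUp, hlist, Function.update_eq_self]

theorem Stable.pushUp_of_subset (hf : (P.pushUp m Y).Stable f) (hXY : X ⊆ Y)
    (hm : P.pushUpBlock m X (f m) = P.pushUpBlock m Y (f m)) : (P.pushUp m X).Stable f := by
  refine ⟨hf.bijective, fun a w h => hf.resists a w ?_⟩
  obtain rfl | ha := eq_or_ne a m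
  · rw [pushUp_man_self] at h ⊢
    exact pushUpList_of_subset hXY hm h
  · rwa [pushUp_man_of_ne ha] at h ⊢

theorem Stable.of_pushUp (hf : (P.pushUp m X).Stable f) (hm : P.WeaklyPrefers m (f m) (P.DA m)) :
    P.Stable f :=
  P.pushUp_empty m ▸
    hf.pushUp_of_subset (Finset.empty_subset X) (pushUpBlock_eq_of_weaklyPrefers hm)

theorem noRegret_iff_DA_eq : P.NoRegret m X ↔ (P.pushUp m X).DA m = P.DA m :=
  ⟨fun h => WeaklyPrefers.antisymm h
    (((P.pushUp m X).stable_DA.of_pushUp h).weaklyPrefers_DA m), Or.inr⟩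

theorem mem_noRegretSet : w ∈ P.noRegretSet m ↔ P.NoRegret m {w} := by
  simp only [noRegretSet, Finset.mem_filter_univ]

theorem stable_pushUp_iff (hm : f m = P.DA m) :
    (P.pushUp m X).Stable f ↔ P.Stable f ∧ ∀ w ∈ X, P.Resists f w m := by
  refine ⟨fun hf => ⟨hf.of_pushUp (Or.inr hm), fun w hw => ?_⟩,
    fun ⟨hf, hX⟩ => ⟨hf.bijective, fun a w h => ?_⟩⟩
  · obtain rfl | hne := eq_or_ne w (P.DA m)
    · exact ⟨m, hm, Or.inl rfl⟩
    · refine hf.resists m w ?_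
      rw [pushUp_man_self, hm]
      exact pushUpList_DA_iff.2 ⟨hne, Or.inr hw⟩
  · obtain rfl | ha := eq_or_ne a m
    · rw [pushUp_man_self, hm, pushUpList_DA_iff] at h
      exact h.2.elim (fun h => hf.resists a w (hm ▸ h)) (hX w)
    · rw [pushUp_man_of_ne ha] at h
      exact hf.resists a w h

theorem Stable.worse_pushUp_union [DecidableEq W] (hf : (P.pushUp m X).Stable f)
    (hg : (P.pushUp m Y).Stable g) (hfm : f m = P.DA m) (hgm : g m = P.DA m) :
    (P.pushUp m (X ∪ Y)).Stable (P.worse f g) ∧ P.worse f g m = P.DA m := by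
  have hm : P.worse f g m = P.DA m :=
    (P.worse_eq_left_or_right f g m).elim (fun h => h.trans hfm) fun h => h.trans hgm
  obtain ⟨hf, hX⟩ := (stable_pushUp_iff hfm).1 hf
  obtain ⟨hg, hY⟩ := (stable_pushUp_iff hgm).1 hg
  refine ⟨(stable_pushUp_iff hm).2 ⟨hf.worse hg, fun w hw => ?_⟩, hm⟩
  exact (Finset.mem_union.1 hw).elim (fun h => hf.resists_worse_left hg (hX w h))
    fun h => hf.resists_worse_right hg (hY w h)

theorem exists_stable_pushUp (hX : X ⊆ P.noRegretSet m) :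
    ∃ f, (P.pushUp m X).Stable f ∧ f m = P.DA m := by
  classical
  induction X using Finset.induction_on with
  | empty => exact ⟨P.DA, (P.pushUp_empty m).symm ▸ P.stable_DA, rfl⟩
  | insert x X _ ih =>
    obtain ⟨hx, hX⟩ := Finset.insert_subset_iff.1 hX
    obtain ⟨f, hf, hfm⟩ := ih hX
    have hxm := noRegret_iff_DA_eq.1 (mem_noRegretSet.1 hx)
    exact ⟨_, (P.pushUp m {x}).stable_DA.worse_pushUp_union hf hxm hfm⟩

theorem Stable.noRegret_or_DA_pushUp_mem (hf : (P.pushUp m X).Stable f) (hm : f m = P.DA m) :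
    P.NoRegret m X ∨ (P.pushUp m X).DA m ≠ P.DA m ∧ (P.pushUp m X).DA m ∈ X := by
  have h := hf.weaklyPrefers_DA m
  rw [hm, WeaklyPrefers, pushUp_man_self, pushUpList_DA_iff] at h
  rcases h with ⟨hne, hman | hmem⟩ | heq
  · exact Or.inl (Or.inl hman)
  · exact Or.inr ⟨hne, hmem⟩
  · exact Or.inl (Or.inr heq)

theorem DA_pushUp_apply_self (hX : X ⊆ P.noRegretSet m) : (P.pushUp m X).DA m = P.DA m := by
  obtain ⟨f, hf, hfm⟩ := exists_stable_pushUp hX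
  refine (hf.noRegret_or_DA_pushUp_mem hfm).elim noRegret_iff_DA_eq.1 fun ⟨hne, hx⟩ => ?_
  -- If `m` got a woman `x ∈ X` whom he pushed up, he would also get her by pushing up `x` alone.
  set x := (P.pushUp m X).DA m
  have hxx : x ∈ ({x} : Finset W) := Finset.mem_singleton_self x
  have hstable : (P.pushUp m {x}).Stable (P.pushUp m X).DA := by
    refine (P.pushUp m X).stable_DA.pushUp_of_subset (Finset.singleton_subset_iff.2 hx) ?_
    rw [pushUpBlock_eq_two hne (Or.inr hxx), pushUpBlock_eq_two hne (Or.inr hx)]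
  have hman : (P.pushUp m {x}).man m x (P.DA m) := by
    rw [pushUp_man_self]
    exact pushUpList_DA_iff.2 ⟨hne, Or.inr hxx⟩
  rw [← noRegret_iff_DA_eq.1 (mem_noRegretSet.1 (hX hx))] at hman
  exact absurd hman (hstable.weaklyPrefers_DA m).not_man

theorem Stable.weaklyPrefers_DA_pushUp (hf : (P.pushUp m X).Stable f) (hm : f m = P.DA m)
    (hX : X ⊆ P.noRegretSet m) (a : M) : P.WeaklyPrefers a ((P.pushUp m X).DA a) (f a) := by
  obtain rfl | ha := eq_or_ne a m
  · exact Or.inr ((DA_pushUp_apply_self hX).trans hm.symm)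
  · have h := hf.weaklyPrefers_DA a
    rwa [WeaklyPrefers, pushUp_man_of_ne ha] at h

theorem weaklyPrefers_DA_pushUp_of_subset (hXY : X ⊆ Y) (hY : Y ⊆ P.noRegretSet m) (a : M) :
    P.WeaklyPrefers a ((P.pushUp m X).DA a) ((P.pushUp m Y).DA a) := by
  have hm := DA_pushUp_apply_self hY
  have hstable := (stable_pushUp_iff hm).1 (P.pushUp m Y).stable_DA
  exact ((stable_pushUp_iff hm).2 ⟨hstable.1, fun w hw => hstable.2 w (hXY hw)⟩)
    |>.weaklyPrefers_DA_pushUp hm (hXY.trans hY) a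

theorem DA_pushUp_union [DecidableEq W] (hX : X ⊆ P.noRegretSet m) (hY : Y ⊆ P.noRegretSet m) :
    (P.pushUp m (X ∪ Y)).DA = P.worse (P.pushUp m X).DA (P.pushUp m Y).DA := by
  have hXY := Finset.union_subset hX hY
  obtain ⟨hstable, hm⟩ := (P.pushUp m X).stable_DA.worse_pushUp_union (P.pushUp m Y).stable_DA
    (DA_pushUp_apply_self hX) (DA_pushUp_apply_self hY)
  ext a
  refine (hstable.weaklyPrefers_DA_pushUp hm hXY a).antisymm ?_
  rcases P.worse_eq_left_or_right (P.pushUp m X).DA (P.pushUp m Y).DA a with h | h <;> rw [h]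
  · exact weaklyPrefers_DA_pushUp_of_subset Finset.subset_union_left hXY a
  · exact weaklyPrefers_DA_pushUp_of_subset Finset.subset_union_right hXY a

end PushUp

section UpperBound

variable {M W : Type*} [Fintype M] [Fintype W] {P : Market M W} {m : M} {Y : Finset W} {y z : W}

/-- A set of no-regret women none of whom can be dropped: no proper subset leads to the same
matching. The matching itself is arbitrary, unlike in `IsMinimumNoRegretPushUpSet`. -/
structure IsIrredundantNoRegretPushUpSet (P : Market M W) (m : M) (Y : Finset W) : Prop where
  subset : Y ⊆ P.noRegretSet m
  DA_ne : ∀ Z ⊂ Y, (P.pushUp m Z).DA ≠ (P.pushUp m Y).DA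

theorem IsMinimumNoRegretPushUpSet.isIrredundant (hY : P.IsMinimumNoRegretPushUpSet m Y) :
    P.IsIrredundantNoRegretPushUpSet m Y where
  subset := hY.1
  DA_ne Z hZ h := hY.2.2 ⟨Z, hZ.1.trans hY.1, h.trans hY.2.1, Finset.card_lt_card hZ⟩

open scoped Classical in
/-- The men whose partners change when the woman `y` is dropped from the push-up set `Y`. -/
noncomputable def movedMen (P : Market M W) (m : M) (Y : Finset W) (y : W) : Finset M :=
  Finset.univ.filter fun a => (P.pushUp m (Y.erase y)).DA a ≠ (P.pushUp m Y).DA a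

theorem IsIrredundantNoRegretPushUpSet.two_le_card_movedMen
    (hY : P.IsIrredundantNoRegretPushUpSet m Y) (hy : y ∈ Y) : 2 ≤ (P.movedMen m Y y).card := by
  classical
  exact two_le_card_filter_ne (DA_bijective _).1 (DA_bijective _).2
    (hY.DA_ne _ (Finset.erase_ssubset hy))

theorem disjoint_movedMen (hY : Y ⊆ P.noRegretSet m) (hyz : y ≠ z) :
    Disjoint (P.movedMen m Y y) (P.movedMen m Y z) := by
  classical
  refine Finset.disjoint_left.2 fun a hay haz => ?_
  have hunion : Y.erase y ∪ Y.erase z = Y := by grind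
  have hDA := DA_pushUp_union ((Y.erase_subset y).trans hY) ((Y.erase_subset z).trans hY)
  rw [hunion] at hDA
  simp only [movedMen, Finset.mem_filter_univ, hDA] at hay haz
  exact (P.worse_eq_left_or_right _ _ a).elim (fun h => hay h.symm) fun h => haz h.symm

theorem notMem_movedMen_self (hY : Y ⊆ P.noRegretSet m) (y : W) : m ∉ P.movedMen m Y y := by
  classical
  simp only [movedMen, Finset.mem_filter_univ, not_not]
  rw [DA_pushUp_apply_self hY, DA_pushUp_apply_self ((Y.erase_subset y).trans hY)]

theorem IsIrredundantNoRegretPushUpSet.two_mul_card_lt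
    (hY : P.IsIrredundantNoRegretPushUpSet m Y) : 2 * Y.card < Fintype.card M := by
  classical
  calc 2 * Y.card
      = ∑ _y ∈ Y, 2 := by rw [Finset.sum_const, smul_eq_mul, mul_comm]
    _ ≤ ∑ y ∈ Y, (P.movedMen m Y y).card :=
        Finset.sum_le_sum fun y hy => hY.two_le_card_movedMen hy
    _ = (Y.biUnion (P.movedMen m Y)).card :=
        (Finset.card_biUnion fun y _ z _ hyz => disjoint_movedMen hY.subset hyz).symm
    _ < Fintype.card M := Finset.card_lt_univ_of_notMem (x := m) fun h => by
        obtain ⟨y, -, hy⟩ := Finset.mem_biUnion.1 h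
        exact notMem_movedMen_self hY.subset y hy

theorem exists_isMinimumNoRegretPushUpSet (P : Market M W) (m : M) :
    ∃ Y, P.IsMinimumNoRegretPushUpSet m Y := by
  obtain ⟨Y, ⟨hY, hDA⟩, hmin⟩ := exists_minimalFor_of_wellFoundedLT
    (fun Y => Y ⊆ P.noRegretSet m ∧ (P.pushUp m Y).DA = (P.pushUp m (P.noRegretSet m)).DA)
    Finset.card ⟨P.noRegretSet m, subset_rfl, rfl⟩
  exact ⟨Y, hY, hDA, fun ⟨Z, hZ, hZDA, hlt⟩ => (hmin ⟨hZ, hZDA⟩ hlt.le).not_gt hlt⟩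

end UpperBound

section RankMarket

variable {M W : Type*} [LinearOrder M] [LinearOrder W]

theorem isStrictTotalOrder_toLex_rank {V : Type*} [LinearOrder V] (r : V → ℕ) :
    IsStrictTotalOrder V fun v v' => toLex (r v, v) < toLex (r v', v') :=
  (RelEmbedding.preimage ⟨fun v => toLex (r v, v), fun _ _ h => (Prod.ext_iff.1 h).2⟩
    (· < ·)).isStrictTotalOrder

variable [Fintype M] [Fintype W]

/-- The market in which every agent orders the other side by a rank, lower ranks being better. Ties
are broken by fixed linear orders, so that the ranks need not be injective. -/
def ofRank (hcard : Fintype.card M = Fintype.card W) (r : M → W → ℕ) (s : W → M → ℕ) :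
    Market M W where
  card_eq := hcard
  man a w w' := toLex (r a w, w) < toLex (r a w', w')
  woman w a a' := toLex (s w a, a) < toLex (s w a', a')
  man_order a := isStrictTotalOrder_toLex_rank (r a)
  woman_order w := isStrictTotalOrder_toLex_rank (s w)

variable {hcard : Fintype.card M = Fintype.card W} {r : M → W → ℕ} {s : W → M → ℕ}

theorem ofRank_man_iff {a : M} {w w' : W} :
    (ofRank hcard r s).man a w w' ↔ r a w < r a w' ∨ r a w = r a w' ∧ w < w' :=
  Prod.Lex.toLex_lt_toLex

theorem ofRank_woman_iff {w : W} {a a' : M} :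
    (ofRank hcard r s).woman w a a' ↔ s w a < s w a' ∨ s w a = s w a' ∧ a < a' :=
  Prod.Lex.toLex_lt_toLex

end RankMarket

section SwapMarket

variable {V : Type*} [Fintype V] [LinearOrder V] {σ : V → V} {o : V} {U X Z T : Finset V}
  {a b w : V}

/-- A market in which the men and the women are indexed by the same set, `σ` matches them up in
pairs, and `o` is the accomplice. The man `a` likes the woman `a` best and the woman `σ a` second.
The woman `w` likes the man `σ w` best; she likes `o` second if `w ∈ U`, and least otherwise. -/
def swapMarket (σ : V → V) (o : V) (U : Finset V) : Market V V :=
  ofRank rfl (fun a w => if w = a then 0 else if w = σ a then 1 else 2)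
    fun w a => if a = σ w then 0 else if a = o then if w ∈ U then 1 else 3 else 2

theorem swapMarket_not_man_self : ¬ (swapMarket σ o U).man a w a := by
  simp only [swapMarket, ofRank_man_iff]
  grind

theorem eq_of_swapMarket_man (h : (swapMarket σ o U).man a w (σ a)) : w = a := by
  simp only [swapMarket, ofRank_man_iff] at h
  grind

theorem swapMarket_woman_swap (h : a ≠ σ w) : (swapMarket σ o U).woman w (σ w) a := by
  simp only [swapMarket, ofRank_woman_iff]
  grind

theorem swapMarket_woman_accomplice_right (hw : w ∉ U) (ha : a ≠ o) (ho : o ≠ σ w) :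
    (swapMarket σ o U).woman w a o := by
  simp only [swapMarket, ofRank_woman_iff]
  grind

theorem swapMarket_woman_accomplice_left (hw : w ∈ U) (ha : a ≠ o) (haw : a ≠ σ w) :
    (swapMarket σ o U).woman w o a := by
  simp only [swapMarket, ofRank_woman_iff]
  grind

theorem swapMarket_DA_apply (a : V) : (swapMarket σ o U).DA a = a :=
  congrFun (DA_eq_of_forall_not_man Function.bijective_id fun _ _ => swapMarket_not_man_self) a

theorem swapMarket_resists {f : V → V} (h : f (σ w) = w) : (swapMarket σ o U).Resists f w b :=
  ⟨σ w, h, (eq_or_ne b (σ w)).imp Eq.symm swapMarket_woman_swap⟩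

theorem swapMarket_stable_ite (hσ : σ.Involutive) (hT : ∀ a, σ a ∈ T ↔ a ∈ T) :
    (swapMarket σ o U).Stable fun a => if a ∈ T then σ a else a := by
  have hinv : Function.Involutive fun a => if a ∈ T then σ a else a := fun a => by
    by_cases ha : a ∈ T <;> simp [ha, hT, hσ a]
  refine ⟨hinv.bijective, fun a w h => ?_⟩
  by_cases ha : a ∈ T
  · rw [if_pos ha] at h
    obtain rfl := eq_of_swapMarket_man h
    exact swapMarket_resists (by rw [if_pos ((hT w).2 ha), hσ w])
  · rw [if_neg ha] at h
    exact absurd h swapMarket_not_man_self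

theorem swapMarket_stable_pushUp_ite (hσ : σ.Involutive) (ho : σ o = o)
    (hT : ∀ a, σ a ∈ T ↔ a ∈ T) (hX : X ∩ U ⊆ T) :
    ((swapMarket σ o U).pushUp o X).Stable fun a => if a ∈ T then σ a else a := by
  refine (stable_pushUp_iff (by rw [ho, ite_self, swapMarket_DA_apply])).2
    ⟨swapMarket_stable_ite hσ hT, fun w hw => ?_⟩
  by_cases hwT : w ∈ T
  · exact swapMarket_resists (by rw [if_pos ((hT w).2 hwT), hσ w])
  · have hwU : w ∉ U := fun h => hwT (hX (Finset.mem_inter.2 ⟨hw, h⟩))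
    refine ⟨w, if_neg hwT, or_iff_not_imp_left.2 fun hwo => ?_⟩
    exact swapMarket_woman_accomplice_right hwU hwo fun h => hwo (by rw [← hσ w, ← h, ho])

theorem swapMarket_stable_pushUp_swap (hσ : σ.Involutive) (ho : σ o = o) :
    ((swapMarket σ o U).pushUp o X).Stable σ := by
  simpa only [Finset.mem_univ, if_true] using
    swapMarket_stable_pushUp_ite (U := U) (T := Finset.univ) hσ ho
      (by simp only [Finset.mem_univ, implies_true]) (X ∩ U).subset_univ

theorem swapMarket_DA_pushUp_eq_or (hσ : σ.Involutive) (ho : σ o = o) (ha : a ≠ o) :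
    ((swapMarket σ o U).pushUp o X).DA a = a ∨ ((swapMarket σ o U).pushUp o X).DA a = σ a := by
  have h := (swapMarket_stable_pushUp_swap (U := U) (X := X) hσ ho).weaklyPrefers_DA a
  rw [WeaklyPrefers, pushUp_man_of_ne ha] at h
  exact h.imp_left eq_of_swapMarket_man

theorem swapMarket_subset_noRegretSet (hσ : σ.Involutive) (ho : σ o = o)
    (hU : ∀ u ∈ U, σ u ∉ U) : U ⊆ (swapMarket σ o U).noRegretSet o := by
  intro u hu
  rw [mem_noRegretSet]
  have huo : u ≠ o := fun h => hU u hu (by rwa [h, ho, ← h])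
  have hσuo : σ u ≠ o := fun h => huo (by rw [← hσ u, h, ho])
  have hσu : σ u ≠ u := fun h => hU u hu (by rwa [h])
  set μ := ((swapMarket σ o U).pushUp o {u}).DA
  have hinj : μ.Injective := (DA_bijective _).1
  -- The men `u` and `σ u` share the women `u` and `σ u`, so neither is left for `o`.
  have hμo : μ o ≠ u := by
    intro h
    have hμu : μ u = σ u :=
      (swapMarket_DA_pushUp_eq_or hσ ho huo).resolve_left fun h' => huo (hinj (h'.trans h.symm))
    rcases swapMarket_DA_pushUp_eq_or hσ ho hσuo with h' | h'
    · exact hσu (hinj (h'.trans hμu.symm))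
    · exact hσuo (hinj (h'.trans ((hσ u).trans h.symm)))
  exact ((swapMarket_stable_pushUp_swap hσ ho).noRegret_or_DA_pushUp_mem
    (ho.trans (swapMarket_DA_apply o).symm)).resolve_right fun h => hμo (Finset.mem_singleton.1 h.2)

theorem swapMarket_subset_of_DA_eq (hσ : σ.Involutive) (ho : σ o = o)
    (hU : ∀ u ∈ U, σ u ∉ U) (hZ : Z ⊆ (swapMarket σ o U).noRegretSet o)
    (hDA : ((swapMarket σ o U).pushUp o Z).DA =
      ((swapMarket σ o U).pushUp o ((swapMarket σ o U).noRegretSet o)).DA) : U ⊆ Z := by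
  intro u hu
  by_contra huZ
  have huo : u ≠ o := fun h => hU u hu (by rwa [h, ho, ← h])
  have huσ : u ≠ σ u := fun h => hU u hu (by rwa [← h])
  have hstable := swapMarket_stable_pushUp_ite (U := U) (X := Z) (T := {u, σ u}ᶜ) hσ ho
    (fun a => by simp [hσ.injective.eq_iff, hσ.eq_iff, and_comm])
    fun w hw => by
      obtain ⟨hwZ, hwU⟩ := Finset.mem_inter.1 hw
      simp only [Finset.mem_compl, Finset.mem_insert, Finset.mem_singleton]
      rintro (rfl | rfl)
      exacts [huZ hwZ, hU u hu hwU]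
  have hμu : ((swapMarket σ o U).pushUp o Z).DA u = u := by
    have h := hstable.weaklyPrefers_DA_pushUp (by rw [ho, ite_self, swapMarket_DA_apply]) hZ u
    rw [if_neg (by simp)] at h
    exact h.resolve_left swapMarket_not_man_self
  have hresists : (swapMarket σ o U).Resists ((swapMarket σ o U).pushUp o Z).DA u o := by
    rw [hDA]
    exact ((stable_pushUp_iff (DA_pushUp_apply_self subset_rfl)).1 (stable_DA _)).2 u
      (swapMarket_subset_noRegretSet hσ ho hU hu)
  obtain ⟨c, hc, h⟩ := hresists
  obtain rfl : c = u := (DA_bijective _).1 (hc.trans hμu.symm)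
  exact h.elim huo (asymm_of _ (swapMarket_woman_accomplice_left hu huo huσ))

end SwapMarket

theorem exists_forall_isMinimum_le_card (n : ℕ) [NeZero n] :
    ∃ (P : Market (Fin n) (Fin n)) (m : Fin n), ∀ Y, P.IsMinimumNoRegretPushUpSet m Y →
      (n - 1) / 2 ≤ Y.card := by
  have hn : 0 < n := NeZero.pos n
  let U : Finset (Fin n) := Finset.Ioc 0 ⟨(n - 1) / 2, by omega⟩
  have hU : ∀ u ∈ U, -u ∉ U := fun u hu hu' => by
    simp only [U, Finset.mem_Ioc, Fin.lt_def, Fin.le_def, Fin.val_zero, Fin.val_neg'] at hu hu'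
    rw [Nat.mod_eq_of_lt (by omega)] at hu'
    omega
  refine ⟨swapMarket Neg.neg 0 U, 0, fun Y hY => ?_⟩
  calc (n - 1) / 2 = U.card := by simp [U]
    _ ≤ Y.card := Finset.card_le_card
      (swapMarket_subset_of_DA_eq neg_involutive neg_zero hU hY.1 hY.2.1)

end Market

theorem mainTheorem6_general (n : ℕ) (hn : 1 ≤ n) :
    (∀ (M : Type*) (W : Type*) [Fintype M] [Fintype W], Fintype.card M = n →
      ∀ (P : Market M W) (m : M) (Y : Finset W),
        P.IsIrredundantNoRegretPushUpSet m Y → Y.card ≤ ⌊((n : ℝ) - 1) / 2⌋₊) ∧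
    (∃ (P : Market (Fin n) (Fin n)) (m : Fin n) (Y : Finset (Fin n)),
      P.IsMinimumNoRegretPushUpSet m Y ∧ Y.card = ⌊((n : ℝ) - 1) / 2⌋₊) := by
  simp only [Nat.floor_div_ofNat, Nat.floor_sub_one, Nat.floor_natCast]
  constructor
  · rintro M W _ _ rfl P m Y hY
    have := hY.two_mul_card_lt
    omega
  · have : NeZero n := ⟨by omega⟩
    obtain ⟨P, m, hle⟩ := Market.exists_forall_isMinimum_le_card n
    obtain ⟨Y, hY⟩ := P.exists_isMinimumNoRegretPushUpSet m
    have hlt := hY.isIrredundant.two_mul_card_lt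
    rw [Fintype.card_fin] at hlt
    exact ⟨P, m, Y, hY, le_antisymm (by omega) (hle Y hY)⟩

theorem mainTheorem6 (n : ℕ) (hn : 1 ≤ n) :
    (∀ (M : Type*) (W : Type*) [Fintype M] [Fintype W],
      Fintype.card M = n → Fintype.card W = n →
        ∀ (P : Market M W) (m : M) (Y : Finset W),
          P.IsMinimumNoRegretPushUpSet m Y → Y.card ≤ ⌊((n : ℝ) - 1) / 2⌋₊) ∧
    (∃ (P : Market (Fin n) (Fin n)) (m : Fin n) (Y : Finset (Fin n)),
      P.IsMinimumNoRegretPushUpSet m Y ∧ Y.card = ⌊((n : ℝ) - 1) / 2⌋₊) := by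
  obtain ⟨hle, htight⟩ := mainTheorem6_general n hn
  exact ⟨fun M W _ _ hM _ P m Y hY => hle M W hM P m Y hY.isIrredundant, htight⟩
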